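/- Let $\mathbb K\in\{\mathbb R,\mathbb C\}$ be the scalar field, let $m\ge 1$ be an integer, let $s_k\in(0,2]$ for $k=1,\dots,m$, and let $s\in(0,\infty]$ be given by $$\frac1s=\frac1{s_1}+\dots+\frac1{s_m}-\frac12$$ (so $s=\infty$ exactly when $m=1$ and $s_1=2$). Definitions. For $0<\sigma\le 2$, an operator $T\in L(X,Y)$ between Banach spaces is called $(\sigma;2)$-nuclear, $T\in N_{\sigma;2}(X,Y)$, if it is nuclear and can be written as $Tx=\sum_{n=1}^\infty a_n\langle x_n',x\rangle y_n$ ($x\in X$) with $x'_n\in X^*$, $\|x_n'\|\le 1$, $(a_n)\in \ell_\sigma$, $y_n\in Y$ and $\sup_{\|y'\|\le1}\bigl(\sum_n|\langle y',y_n\rangle|^2\bigr)^{1/2}<\infty$. For a Hilbert space $H$ and $0<p\le\infty$, $S_p(H)$ is the Schatten class of all compact operators $U$ on $H$ whose sequence of singular numbers (the eigenvalues of $(U^*U)^{1/2}$ in non-increasing order, with multiplicity) lies in $\ell_p$; in particular $S_\infty(H)$ is the class of compact operators. An operator $T\in L(X,Y)$ factors through an operator from $S_p(H)$ if $T=BUA$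 with $A\in L(X,H)$, $U\in S_p(H)$, $B\in L(H,Y)$. Theorem. There exist operators $T_k\in N_{s_k;2}(\ell_1,\ell_1)$, $k=1,\dots,m$, such that the composition $T:=T_mT_{m-1}\cdots T_1$ factors through an operator from $S_s(\ell_2)$, but for every $t\in(0,s)$ and every Hilbert space $H$ it does not factor through any operator from $S_t(H)$. -/

import Mathlib

open scoped ENNReal

noncomputable section

/-- The sequence space `ℓ_1` over the scalar field `𝕜`. -/
abbrev EllOne (𝕜 : Type*) [RCLike 𝕜] : Type _ := lp (fun _ : ℕ => 𝕜) 1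

/-- The Hilbert space `ℓ_2` over the scalar field `𝕜`. -/
abbrev EllTwo (𝕜 : Type*) [RCLike 𝕜] : Type _ := lp (fun _ : ℕ => 𝕜) 2

section Nuclear

variable {𝕜 : Type*} [RCLike 𝕜]
variable {X : Type*} [NormedAddCommGroup X] [NormedSpace 𝕜 X]
variable {Y : Type*} [NormedAddCommGroup Y] [NormedSpace 𝕜 Y]

/-- The weak `ℓ_2`-norm `sup_{‖y'‖ ≤ 1} (∑ₙ |⟨y', yₙ⟩|²)^{1/2}` of a sequence `(yₙ)`, with values
in `[0, ∞]`. -/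
def weakTwoNorm (𝕜 : Type*) [RCLike 𝕜] {Y : Type*} [NormedAddCommGroup Y] [NormedSpace 𝕜 Y]
    (y : ℕ → Y) : ℝ≥0∞ :=
  ⨆ (y' : Y →L[𝕜] 𝕜) (_ : ‖y'‖ ≤ 1), (∑' n, ‖y' (y n)‖ₑ ^ (2 : ℝ)) ^ (1 / 2 : ℝ)

/-- `T` is nuclear: `T x = ∑ₙ ⟨x'ₙ, x⟩ yₙ` with `∑ₙ ‖x'ₙ‖ ‖yₙ‖ < ∞`. -/
def IsNuclearOp (T : X →L[𝕜] Y) : Prop :=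
  ∃ (x' : ℕ → X →L[𝕜] 𝕜) (y : ℕ → Y),
    Summable (fun n => ‖x' n‖ * ‖y n‖) ∧ ∀ x : X, HasSum (fun n => x' n x • y n) (T x)

/-- `T` is `(s;2)`-nuclear: it is a nuclear operator which admits a representation
`T x = ∑ₙ aₙ ⟨x'ₙ, x⟩ yₙ` with `‖x'ₙ‖ ≤ 1`, `(aₙ) ∈ ℓ_s` and `(yₙ)` weakly 2-summable. -/
def IsSTwoNuclear (s : ℝ) (T : X →L[𝕜] Y) : Prop :=
  IsNuclearOp T ∧
  ∃ (a : ℕ → 𝕜) (x' : ℕ → X →L[𝕜] 𝕜) (y : ℕ → Y),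
    (∀ n, ‖x' n‖ ≤ 1) ∧ Memℓp a (ENNReal.ofReal s) ∧ weakTwoNorm 𝕜 y < ∞ ∧
      ∀ x : X, HasSum (fun n => (a n * x' n x) • y n) (T x)

end Nuclear

section Schatten

variable {𝕜 : Type*} [RCLike 𝕜]
variable {H : Type*} [NormedAddCommGroup H] [InnerProductSpace 𝕜 H] [CompleteSpace H]

/-- The span of the eigenvectors of `|U| = (U* U)^{1/2}` whose eigenvalue exceeds `r` (for `r ≥ 0`);
`l > 0` is an eigenvalue of `|U|` exactly when `l²` is an eigenvalue of `U* U`, with the same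
eigenspace. -/
def singularSpace (U : H →L[𝕜] H) (r : ℝ) : Submodule 𝕜 H :=
  ⨆ (l : ℝ) (_ : r < l),
    Module.End.eigenspace ((ContinuousLinearMap.adjoint U ∘L U : H →L[𝕜] H) : H →ₗ[𝕜] H)
      ((l ^ 2 : ℝ) : 𝕜)

/-- The singular numbers of a compact operator `U`: the eigenvalues of `|U| = (U* U)^{1/2}`, counted
with multiplicity, in non-increasing order (and continued by zeros if there are only finitely many
positive ones). The index starts at `0`: `singularNumber U n` is the smallest `r ≥ 0` such that at
most `n` eigenvalues of `|U|`, counted with multiplicity, are larger than `r`. -/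
def singularNumber (U : H →L[𝕜] H) (n : ℕ) : ℝ :=
  sInf {r : ℝ | 0 ≤ r ∧ Module.rank 𝕜 (singularSpace U r) ≤ n}

/-- The Schatten class `S_p(H)`, `0 < p ≤ ∞`: compact operators whose singular numbers lie in `ℓ_p`.
For `p = ∞` this is the space of all compact operators. -/
def IsSchatten (p : ℝ≥0∞) (U : H →L[𝕜] H) : Prop :=
  IsCompactOperator U ∧ Memℓp (fun n => singularNumber U n) p

end Schatten

/-- `T : X → Y` factors through an operator from `S_p(H)`: `T = B U A` with `A ∈ L(X, H)`,
`U ∈ S_p(H)`, `B ∈ L(H, Y)`. -/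
def FactorsThroughSchatten {𝕜 : Type*} [RCLike 𝕜]
    {X : Type*} [NormedAddCommGroup X] [NormedSpace 𝕜 X]
    {Y : Type*} [NormedAddCommGroup Y] [NormedSpace 𝕜 Y]
    (H : Type*) [NormedAddCommGroup H] [InnerProductSpace 𝕜 H] [CompleteSpace H]
    (p : ℝ≥0∞) (T : X →L[𝕜] Y) : Prop :=
  ∃ (A : X →L[𝕜] H) (U : H →L[𝕜] H) (B : H →L[𝕜] Y), IsSchatten p U ∧ T = B ∘L U ∘L A

end

noncomputable section

section SingularNumbers

variable {𝕜 : Type*} [RCLike 𝕜]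
variable {H : Type*} [NormedAddCommGroup H] [InnerProductSpace 𝕜 H] [CompleteSpace H]

lemma inner_adjoint_comp_self (U : H →L[𝕜] H) (x y : H) :
    inner 𝕜 ((ContinuousLinearMap.adjoint U ∘L U) x) y = inner 𝕜 (U x) (U y) := by
  simp [ContinuousLinearMap.adjoint_inner_left]

lemma norm_sq_eq_of_mem_eigenspace {U : H →L[𝕜] H} {μ : 𝕜} {x : H}
    (hx : (ContinuousLinearMap.adjoint U ∘L U) x = μ • x) :
    ((‖U x‖ ^ 2 : ℝ) : 𝕜) = μ * ((‖x‖ ^ 2 : ℝ) : 𝕜) := by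
  have h := ContinuousLinearMap.adjoint_inner_right U x (U x)
  have h2 : (ContinuousLinearMap.adjoint U) (U x) = μ • x := hx
  rw [h2, inner_smul_right, inner_self_eq_norm_sq_to_K, inner_self_eq_norm_sq_to_K] at h
  push_cast
  exact h.symm

lemma singularSpace_antitone (U : H →L[𝕜] H) : Antitone (singularSpace U) := fun _ _ hab =>
  iSup_mono fun _ => iSup_mono' fun h => ⟨lt_of_le_of_lt hab h, le_rfl⟩

lemma singularSpace_norm (U : H →L[𝕜] H) : singularSpace U ‖U‖ = ⊥ := by
  rw [eq_bot_iff]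
  refine iSup₂_le fun l hl x hx => ?_
  rw [Module.End.mem_eigenspace_iff] at hx
  have h := norm_sq_eq_of_mem_eigenspace (U := U) (x := x) hx
  have h' : ‖U x‖ ^ 2 = l ^ 2 * ‖x‖ ^ 2 := by exact_mod_cast h
  rw [Submodule.mem_bot]
  by_contra hne
  have hx0 : 0 < ‖x‖ := norm_pos_iff.2 hne
  have h1 := U.le_opNorm x
  have h2 : ‖U‖ * ‖x‖ < l * ‖x‖ := mul_lt_mul_of_pos_right hl hx0
  have h3 : ‖U x‖ < l * ‖x‖ := lt_of_le_of_lt h1 h2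
  have h4 := pow_lt_pow_left₀ h3 (norm_nonneg _) two_ne_zero
  rw [mul_pow] at h4
  exact absurd h' h4.ne

lemma singularNumber_set_bddBelow (U : H →L[𝕜] H) (n : ℕ) :
    BddBelow {r : ℝ | 0 ≤ r ∧ Module.rank 𝕜 (singularSpace U r) ≤ n} :=
  ⟨0, fun _ hr => hr.1⟩

lemma singularNumber_set_nonempty (U : H →L[𝕜] H) (n : ℕ) :
    {r : ℝ | 0 ≤ r ∧ Module.rank 𝕜 (singularSpace U r) ≤ n}.Nonempty :=
  ⟨‖U‖, norm_nonneg _, by rw [singularSpace_norm]; simp⟩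

lemma singularNumber_nonneg (U : H →L[𝕜] H) (n : ℕ) : 0 ≤ singularNumber U n :=
  Real.sInf_nonneg fun _ hr => hr.1

lemma singularNumber_le {U : H →L[𝕜] H} {n : ℕ} {r : ℝ} (hr : 0 ≤ r)
    (h : Module.rank 𝕜 (singularSpace U r) ≤ n) : singularNumber U n ≤ r :=
  csInf_le (singularNumber_set_bddBelow U n) ⟨hr, h⟩

lemma rank_singularSpace_le {U : H →L[𝕜] H} {n : ℕ} {r : ℝ} (h : singularNumber U n < r) :
    Module.rank 𝕜 (singularSpace U r) ≤ n := by
  obtain ⟨q, ⟨_, hq⟩, hqr⟩ := exists_lt_of_csInf_lt (singularNumber_set_nonempty U n) h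
  exact (Submodule.rank_mono (singularSpace_antitone U hqr.le)).trans hq

lemma singularNumber_antitone (U : H →L[𝕜] H) : Antitone (singularNumber U) := fun m n hmn =>
  csInf_le_csInf (singularNumber_set_bddBelow U n) (singularNumber_set_nonempty U m)
    fun _ hr => ⟨hr.1, hr.2.trans (by exact_mod_cast hmn)⟩

lemma exists_singularNumber_le_rpow {U : H →L[𝕜] H} {t : ℝ≥0∞} (ht : 0 < t.toReal)
    (h : Memℓp (fun n => singularNumber U n) t) :
    ∃ C : ℝ, 0 < C ∧ ∀ n : ℕ, singularNumber U n ≤ C * ((n : ℝ) + 1) ^ (-(1 / t.toReal)) := by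
  have hs := (memℓp_gen_iff ht).1 h
  set p := t.toReal
  set S := ∑' n, ‖singularNumber U n‖ ^ p
  have hS : 0 ≤ S := tsum_nonneg fun n => by positivity
  refine ⟨(S + 1) ^ (1 / p), by positivity, fun n => ?_⟩
  have h0 := singularNumber_nonneg U n
  have h1 : ((n : ℝ) + 1) * singularNumber U n ^ p ≤ S := by
    calc ((n : ℝ) + 1) * singularNumber U n ^ p
        = ∑ i ∈ Finset.range (n + 1), singularNumber U n ^ p := by simp
      _ ≤ ∑ i ∈ Finset.range (n + 1), ‖singularNumber U i‖ ^ p := by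
          refine Finset.sum_le_sum fun i hi => ?_
          rw [Real.norm_of_nonneg (singularNumber_nonneg U i)]
          exact Real.rpow_le_rpow h0
            (singularNumber_antitone U (Nat.lt_succ_iff.1 (Finset.mem_range.1 hi))) ht.le
      _ ≤ S := hs.sum_le_tsum _ fun i _ => by positivity
  have hn : (0 : ℝ) < (n : ℝ) + 1 := by positivity
  have h2 : singularNumber U n ^ p ≤ (S + 1) * ((n : ℝ) + 1)⁻¹ := by
    rw [← div_eq_mul_inv, le_div_iff₀ hn]; linarith
  calc singularNumber U n = (singularNumber U n ^ p) ^ (1 / p) := by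
        rw [← Real.rpow_mul h0, mul_one_div_cancel ht.ne', Real.rpow_one]
    _ ≤ ((S + 1) * ((n : ℝ) + 1)⁻¹) ^ (1 / p) := by
        apply Real.rpow_le_rpow (by positivity) h2 (by positivity)
    _ = (S + 1) ^ (1 / p) * ((n : ℝ) + 1) ^ (-(1 / p)) := by
        rw [Real.mul_rpow (by positivity) (by positivity), Real.inv_rpow hn.le,
          ← Real.rpow_neg hn.le]

/-- On the orthogonal complement of the eigenspaces of `|U|` with eigenvalue larger than `r`, a
compact operator `U` has norm at most `r`. -/
lemma norm_apply_le_of_mem_orthogonal_singularSpace {U : H →L[𝕜] H} (hU : IsCompactOperator U)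
    {r : ℝ} (hr : 0 ≤ r) {x : H} (hx : x ∈ (singularSpace U r)ᗮ) : ‖U x‖ ≤ r * ‖x‖ := by
  set G : H →L[𝕜] H := ContinuousLinearMap.adjoint U ∘L U with hG
  have hGc : IsCompactOperator G := hU.clm_comp (ContinuousLinearMap.adjoint U)
  have hGs : ∀ x y, inner 𝕜 (G x) y = inner 𝕜 x (G y) := fun x y => by
    rw [hG, inner_adjoint_comp_self, ← inner_conj_symm x, inner_adjoint_comp_self, inner_conj_symm]
  have hinv : ∀ l : ℝ, ∀ y ∈ Module.End.eigenspace (G : H →ₗ[𝕜] H) ((l ^ 2 : ℝ) : 𝕜),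
      ∀ v ∈ (singularSpace U r)ᗮ, r < l → inner 𝕜 y (G v) = 0 := by
    intro l y hy v hv hl
    have hy' : G y = ((l ^ 2 : ℝ) : 𝕜) • y := Module.End.mem_eigenspace_iff.1 hy
    have hyS : y ∈ singularSpace U r := Submodule.mem_iSup_of_mem l (Submodule.mem_iSup_of_mem hl hy)
    rw [← hGs, hy', inner_smul_left, hv y hyS, mul_zero]
  have hinv' : ∀ v ∈ (singularSpace U r)ᗮ, (G : H →ₗ[𝕜] H) v ∈ (singularSpace U r)ᗮ := by
    intro v hv
    have : singularSpace U r ≤ (Submodule.span 𝕜 {G v})ᗮ := by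
      refine iSup₂_le fun l hl y hy => ?_
      rw [Submodule.mem_orthogonal_singleton_iff_inner_left]
      exact hinv l y hy v hv hl
    intro y hy
    exact Submodule.mem_orthogonal_singleton_iff_inner_left.1 (this hy)
  let R : (singularSpace U r)ᗮ →L[𝕜] (singularSpace U r)ᗮ := G.restrict hinv'
  have hRc : IsCompactOperator R := hGc.restrict' hinv'
  have hRs : R.IsSymmetric := fun a b => hGs a b
  have hnorm : ‖R‖ ≤ r ^ 2 := by
    by_contra hlt
    push Not at hlt
    have hsr := R.spectralRadius_eq_nnnorm hRs.isSelfAdjoint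
    have h1 : ENNReal.ofReal (r ^ 2) < spectralRadius 𝕜 R := by
      rw [hsr, ← enorm_eq_nnnorm, ← ofReal_norm]
      exact (ENNReal.ofReal_lt_ofReal_iff (lt_of_le_of_lt (sq_nonneg r) hlt)).2 hlt
    rw [spectralRadius] at h1
    obtain ⟨μ, hμ⟩ := lt_iSup_iff.1 h1
    obtain ⟨hμs, hμ⟩ := lt_iSup_iff.1 hμ
    rw [← enorm_eq_nnnorm, ← ofReal_norm] at hμ
    have hμr : r ^ 2 < ‖μ‖ := (ENNReal.ofReal_lt_ofReal_iff_of_nonneg (sq_nonneg r)).1 hμ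
    have hμ0 : μ ≠ 0 := norm_pos_iff.1 (lt_of_le_of_lt (sq_nonneg r) hμr)
    obtain ⟨v, hv, hv0⟩ := ((hRc.hasEigenvalue_iff_mem_spectrum hμ0).2 hμs).exists_hasEigenvector
    have hv1 : R v = μ • v := Module.End.mem_eigenspace_iff.1 hv
    have hv2 : G (v : H) = μ • (v : H) := congrArg Subtype.val hv1
    have hvn : ‖(v : H)‖ ^ 2 ≠ 0 := by
      simpa using hv0
    have hμe := norm_sq_eq_of_mem_eigenspace hv2
    have hμe2 : μ = ((‖U v‖ ^ 2 / ‖(v : H)‖ ^ 2 : ℝ) : 𝕜) := by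
      rw [RCLike.ofReal_div, hμe, mul_div_cancel_right₀]
      exact_mod_cast hvn
    have hq : 0 ≤ ‖U v‖ ^ 2 / ‖(v : H)‖ ^ 2 := by positivity
    set q := ‖U v‖ ^ 2 / ‖(v : H)‖ ^ 2
    have hrq : r ^ 2 < q := by
      rwa [hμe2, RCLike.norm_ofReal, abs_of_nonneg hq] at hμr
    have hvS : (v : H) ∈ singularSpace U r := by
      refine Submodule.mem_iSup_of_mem (Real.sqrt q)
        (Submodule.mem_iSup_of_mem (Real.lt_sqrt_of_sq_lt hrq) ?_)
      rw [Real.sq_sqrt hq, Module.End.mem_eigenspace_iff, ← hμe2]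
      exact hv2
    have := v.2 v hvS
    rw [inner_self_eq_zero] at this
    exact hv0 (Subtype.ext this)
  have h2 : ‖U x‖ ^ 2 ≤ (r * ‖x‖) ^ 2 := by
    have h3 : ‖U x‖ ^ 2 = RCLike.re (inner 𝕜 (G x) x) := by
      rw [hG, inner_adjoint_comp_self, inner_self_eq_norm_sq]
    have h4 : ‖G x‖ ≤ r ^ 2 * ‖x‖ := by
      have := R.le_of_opNorm_le hnorm ⟨x, hx⟩
      exact this
    rw [h3]
    refine (RCLike.re_le_norm _).trans ((norm_inner_le_norm _ _).trans ?_)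
    nlinarith [norm_nonneg x]
  exact le_of_sq_le_sq h2 (by positivity)

end SingularNumbers

section HilbertSchmidt

/-- Some choice of signs makes the norm of a signed sum at least the `ℓ₂`-sum of the norms. -/
lemma exists_sign_sum_norm_sq_le {𝕜 H : Type*} [RCLike 𝕜] [NormedAddCommGroup H]
    [InnerProductSpace 𝕜 H] {ι : Type*} (s : Finset ι) (h : ι → H) :
    ∃ ε : ι → 𝕜, (∀ i, ‖ε i‖ = 1) ∧ ∑ i ∈ s, ‖h i‖ ^ 2 ≤ ‖∑ i ∈ s, ε i • h i‖ ^ 2 := by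
  classical
  induction s using Finset.induction_on with
  | empty => exact ⟨fun _ => 1, by simp⟩
  | insert a s ha ih =>
    obtain ⟨ε, hε, hs⟩ := ih
    have key : ∀ c : 𝕜, ∑ i ∈ insert a s, Function.update ε a c i • h i
        = ∑ i ∈ s, ε i • h i + c • h a := by
      intro c
      rw [Finset.sum_insert ha, add_comm, Function.update_self]
      congr 1
      refine Finset.sum_congr rfl fun i hi => ?_
      rw [Function.update_of_ne (ne_of_mem_of_not_mem hi ha)]
    have hup : ∀ c : 𝕜, ‖c‖ = 1 → ∀ i, ‖Function.update ε a c i‖ = 1 := by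
      intro c hc i
      rcases eq_or_ne i a with rfl | hi
      · simpa using hc
      · rw [Function.update_of_ne hi, hε]
    set v := ∑ i ∈ s, ε i • h i
    have hp := parallelogram_law_with_norm 𝕜 v (h a)
    by_cases hc : ‖v‖ ^ 2 + ‖h a‖ ^ 2 ≤ ‖v + h a‖ ^ 2
    · refine ⟨Function.update ε a 1, hup 1 (by simp), ?_⟩
      rw [key, one_smul, Finset.sum_insert ha]
      linarith
    · refine ⟨Function.update ε a (-1), hup (-1) (by simp), ?_⟩
      rw [key, neg_one_smul, Finset.sum_insert ha, ← sub_eq_add_neg]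
      nlinarith

variable {𝕜 : Type*} [RCLike 𝕜]
variable {H : Type*} [NormedAddCommGroup H] [InnerProductSpace 𝕜 H] [CompleteSpace H]
variable {E : Type*} [NormedAddCommGroup E] [InnerProductSpace 𝕜 E] [FiniteDimensional 𝕜 E]

lemma sum_norm_sq_eq_re_trace {ι : Type*} [Fintype ι] (L : E →ₗ[𝕜] H) (b : OrthonormalBasis ι 𝕜 E) :
    haveI := FiniteDimensional.complete 𝕜 E
    ∑ i, ‖L (b i)‖ ^ 2 = RCLike.re (LinearMap.trace 𝕜 E
      (ContinuousLinearMap.adjoint (LinearMap.toContinuousLinearMap L) ∘L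
        LinearMap.toContinuousLinearMap L : E →L[𝕜] E)) := by
  have := FiniteDimensional.complete 𝕜 E
  rw [LinearMap.trace_eq_sum_inner _ b, map_sum]
  refine Finset.sum_congr rfl fun i _ => ?_
  simp [ContinuousLinearMap.adjoint_inner_right]

lemma Orthonormal.sum_norm_sq_apply_le {ι κ : Type*} [Fintype ι] [Fintype κ] (L : E →ₗ[𝕜] H)
    (b : OrthonormalBasis ι 𝕜 E) {v : κ → E} (hv : Orthonormal 𝕜 v) :
    ∑ k, ‖L (v k)‖ ^ 2 ≤ ∑ i, ‖L (b i)‖ ^ 2 := by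
  classical
  obtain ⟨u, b', hu, hb'⟩ := ((orthonormal_subtype_range
    hv.linearIndependent.injective).2 hv).exists_orthonormalBasis_extension
  rw [sum_norm_sq_eq_re_trace L b, ← sum_norm_sq_eq_re_trace L b']
  have h1 : ∑ k, ‖L (v k)‖ ^ 2 = ∑ x ∈ Finset.univ.image v, ‖L x‖ ^ 2 := by
    rw [Finset.sum_image fun a _ c _ h => hv.linearIndependent.injective h]
  rw [h1, hb', Finset.sum_coe_sort u fun x => ‖L x‖ ^ 2]
  refine Finset.sum_le_sum_of_subset_of_nonneg (fun x hx => ?_) fun _ _ _ => by positivity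
  obtain ⟨k, _, rfl⟩ := Finset.mem_image.1 hx
  exact hu ⟨k, rfl⟩

/-- If `B U A` is a multiple `δ` of an isometry on a finite-dimensional Hilbert space, then `δ` is
controlled by the Hilbert-Schmidt norms of `A` and `B` and by the singular numbers of `U`. -/
lemma sub_mul_le_of_comp_isometry {ι : Type*} [Fintype ι] (b : OrthonormalBasis ι 𝕜 E)
    (A : E →L[𝕜] H) (U : H →L[𝕜] H) (hU : IsCompactOperator U) (B : H →L[𝕜] E)
    (B' : E →L[𝕜] H) (hB' : ∀ x y, inner 𝕜 x (B y) = inner 𝕜 (B' x) y)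
    {δ ρ α β : ℝ} (hδ : 0 < δ) (hρ : 0 ≤ ρ) (hα : 0 ≤ α) (hβ : 0 ≤ β) {r : ℕ}
    (hr : Module.rank 𝕜 (singularSpace U ρ) ≤ r) (hM : ∀ k, ‖B (U (A k))‖ = δ * ‖k‖)
    (hA : ∑ i, ‖A (b i)‖ ^ 2 ≤ α ^ 2) (hB : ∑ i, ‖B' (b i)‖ ^ 2 ≤ β ^ 2) :
    ((Fintype.card ι : ℝ) - r) * δ ≤ ρ * (β * α) := by
  set S := singularSpace U ρ
  have : FiniteDimensional 𝕜 S :=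
    Module.rank_lt_aleph0_iff.1 (hr.trans_lt (Cardinal.natCast_lt_aleph0))
  have hSr : Module.finrank 𝕜 S ≤ r := Module.finrank_le_of_rank_le hr
  let P : E →ₗ[𝕜] S := (S.orthogonalProjectionOnto ∘L A : E →L[𝕜] S)
  let K := LinearMap.ker P
  have hK : (Fintype.card ι : ℝ) - r ≤ Module.finrank 𝕜 K := by
    have h1 := LinearMap.finrank_range_add_finrank_ker P
    have h2 := Submodule.finrank_le (LinearMap.range P)
    rw [Module.finrank_eq_card_basis b.toBasis] at h1
    have h3 : Module.finrank 𝕜 K = Module.finrank 𝕜 (LinearMap.ker P) := rfl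
    have : (Fintype.card ι : ℝ) ≤ Module.finrank 𝕜 K + r := by
      exact_mod_cast (by omega : Fintype.card ι ≤ Module.finrank 𝕜 K + r)
    linarith
  have hKS : ∀ k ∈ K, A k ∈ Sᗮ := by
    intro k hk
    have : S.orthogonalProjectionOnto (A k) = 0 := hk
    exact Submodule.orthogonalProjectionOnto_eq_zero_iff.1 this
  let v := fun j => ((stdOrthonormalBasis 𝕜 K j : K) : E)
  have hv : Orthonormal 𝕜 v := (stdOrthonormalBasis 𝕜 K).orthonormal.comp_linearIsometry K.subtypeₗᵢ
  let M : E →ₗᵢ[𝕜] E :=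
    { toLinearMap := ((δ⁻¹ : ℝ) : 𝕜) • ((B ∘L U ∘L A : E →L[𝕜] E) : E →ₗ[𝕜] E)
      norm_map' := fun k => by
        have := hM k
        simp only [LinearMap.smul_apply, ContinuousLinearMap.coe_coe,
          ContinuousLinearMap.comp_apply, norm_smul, RCLike.norm_ofReal, this]
        rw [abs_of_pos (inv_pos.2 hδ)]
        field_simp }
  have hMe : ∀ k, B (U (A k)) = (δ : 𝕜) • M k := by
    intro k
    change _ = (δ : 𝕜) • (((δ⁻¹ : ℝ) : 𝕜) • B (U (A k)))
    rw [smul_smul, ← RCLike.ofReal_mul, mul_inv_cancel₀ hδ.ne', RCLike.ofReal_one, one_smul]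
  have hw : Orthonormal 𝕜 (M ∘ v) := hv.comp_linearIsometry M
  have hj : ∀ j, δ ≤ ρ * (‖B' (M (v j))‖ * ‖A (v j)‖) := by
    intro j
    have h1 : inner 𝕜 (M (v j)) (B (U (A (v j)))) = (δ : 𝕜) := by
      rw [hMe, inner_smul_right, inner_self_eq_norm_sq_to_K, M.norm_map, hv.1 j]
      simp
    rw [hB'] at h1
    have h2 := norm_inner_le_norm (𝕜 := 𝕜) (B' (M (v j))) (U (A (v j)))
    rw [h1, RCLike.norm_ofReal, abs_of_pos hδ] at h2
    have h3 := norm_apply_le_of_mem_orthogonal_singularSpace hU hρ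
      (hKS (v j) (stdOrthonormalBasis 𝕜 K j).2)
    calc δ ≤ ‖B' (M (v j))‖ * ‖U (A (v j))‖ := h2
      _ ≤ ‖B' (M (v j))‖ * (ρ * ‖A (v j)‖) := by gcongr
      _ = _ := by ring
  calc ((Fintype.card ι : ℝ) - r) * δ ≤ Module.finrank 𝕜 K * δ := by gcongr
    _ = ∑ j : Fin (Module.finrank 𝕜 K), δ := by simp
    _ ≤ ∑ j, ρ * (‖B' (M (v j))‖ * ‖A (v j)‖) := Finset.sum_le_sum fun j _ => hj j
    _ = ρ * ∑ j, ‖B' (M (v j))‖ * ‖A (v j)‖ := by rw [Finset.mul_sum]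
    _ ≤ ρ * (β * α) := by
        gcongr
        refine (Real.sum_mul_le_sqrt_mul_sqrt _ _ _).trans ?_
        gcongr
        · exact Real.sqrt_le_iff.2 ⟨hβ, (hw.sum_norm_sq_apply_le (B' : E →ₗ[𝕜] H) b).trans hB⟩
        · exact Real.sqrt_le_iff.2 ⟨hα, (hv.sum_norm_sq_apply_le (A : E →ₗ[𝕜] H) b).trans hA⟩

end HilbertSchmidt

section Walsh

open scoped Matrix Kronecker

lemma exists_unitary_matrix_flat (𝕜 : Type*) [RCLike 𝕜] (n : ℕ) :
    ∃ M : Matrix (Fin (2 ^ n)) (Fin (2 ^ n)) 𝕜,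
      Mᴴ * M = 1 ∧ ∀ i j, ‖M i j‖ ≤ (√(2 ^ n))⁻¹ := by
  induction n with
  | zero =>
    refine ⟨1, by simp, fun i j => ?_⟩
    obtain rfl : i = j := Fin.ext (by omega)
    simp
  | succ n ih =>
    obtain ⟨M, hM, hn⟩ := ih
    let c : 𝕜 := ((√2)⁻¹ : ℝ)
    have hcc : c * c = 2⁻¹ := by
      have : (√2 : ℝ)⁻¹ * (√2)⁻¹ = 2⁻¹ := by
        rw [← mul_inv, Real.mul_self_sqrt (by norm_num)]
      rw [← RCLike.ofReal_mul, this, RCLike.ofReal_inv, RCLike.ofReal_ofNat]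
    have hcs : star c = c := RCLike.conj_ofReal _
    have hcn : ‖c‖ = (√2)⁻¹ := by
      rw [RCLike.norm_ofReal, abs_of_nonneg (by positivity)]
    let F : Matrix (Fin 2) (Fin 2) 𝕜 := !![c, c; c, -c]
    have hF : Fᴴ * F = 1 := by
      have h2 : (2⁻¹ : 𝕜) + 2⁻¹ = 1 := by rw [← two_mul, mul_inv_cancel₀ two_ne_zero]
      ext i j
      fin_cases i <;> fin_cases j <;>
        simp [F, Matrix.mul_apply, Fin.sum_univ_two, Matrix.conjTranspose_apply, hcc, h2, -RCLike.star_def,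
          hcs]
    have hFn : ∀ i j, ‖F i j‖ ≤ (√2)⁻¹ := by
      intro i j
      fin_cases i <;> fin_cases j <;> simp [F, hcn]
    let e : Fin 2 × Fin (2 ^ n) ≃ Fin (2 ^ (n + 1)) :=
      finProdFinEquiv.trans (finCongr (by rw [pow_succ, mul_comm]))
    refine ⟨(F ⊗ₖ M).submatrix e.symm e.symm, ?_, fun i j => ?_⟩
    · rw [Matrix.conjTranspose_submatrix, Matrix.submatrix_mul_equiv, Matrix.conjTranspose_kronecker,
        ← Matrix.mul_kronecker_mul, hF, hM, Matrix.one_kronecker_one, Matrix.submatrix_one_equiv]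
    · rw [Matrix.submatrix_apply, Matrix.kroneckerMap_apply, norm_mul]
      have h : (√(2 ^ (n + 1)) : ℝ)⁻¹ = (√2)⁻¹ * (√(2 ^ n))⁻¹ := by
        rw [pow_succ, mul_comm, Real.sqrt_mul (by positivity), mul_inv]
      rw [h]
      exact mul_le_mul (hFn _ _) (hn _ _) (norm_nonneg _) (by positivity)

variable {𝕜 : Type*} [RCLike 𝕜]

/-- A unitary matrix of size `2 ^ n` all of whose entries have modulus at most `2 ^ (-n / 2)`. -/
def flatMatrix (𝕜 : Type*) [RCLike 𝕜] (n : ℕ) : Matrix (Fin (2 ^ n)) (Fin (2 ^ n)) 𝕜 :=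
  (exists_unitary_matrix_flat 𝕜 n).choose

lemma flatMatrix_conjTranspose_mul (n : ℕ) : (flatMatrix 𝕜 n)ᴴ * flatMatrix 𝕜 n = 1 :=
  (exists_unitary_matrix_flat 𝕜 n).choose_spec.1

lemma norm_flatMatrix_le (n : ℕ) (i j : Fin (2 ^ n)) : ‖flatMatrix 𝕜 n i j‖ ≤ (√(2 ^ n))⁻¹ :=
  (exists_unitary_matrix_flat 𝕜 n).choose_spec.2 i j

lemma sum_norm_sq_mulVec_of_unitary {ι : Type*} [Fintype ι] [DecidableEq ι] {M : Matrix ι ι 𝕜}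
    (hM : Mᴴ * M = 1) (v : ι → 𝕜) : ∑ i, ‖(M *ᵥ v) i‖ ^ 2 = ∑ i, ‖v i‖ ^ 2 := by
  have key : ∀ w : ι → 𝕜, ((∑ i, ‖w i‖ ^ 2 : ℝ) : 𝕜) = star w ⬝ᵥ w := by
    intro w
    simp [dotProduct, RCLike.conj_mul]
  have : ((∑ i, ‖(M *ᵥ v) i‖ ^ 2 : ℝ) : 𝕜) = ((∑ i, ‖v i‖ ^ 2 : ℝ) : 𝕜) := by
    rw [key, key, Matrix.star_mulVec, Matrix.dotProduct_mulVec, Matrix.vecMul_vecMul, hM,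
      Matrix.vecMul_one]
  exact_mod_cast this

/-- The index of the dyadic block `[2 ^ n - 1, 2 ^ (n + 1) - 1)` which contains `i`. -/
def blockIndex (i : ℕ) : ℕ := Nat.log 2 (i + 1)

lemma lt_pow_blockIndex_succ (i : ℕ) : i + 1 < 2 ^ (blockIndex i + 1) :=
  Nat.lt_pow_succ_log_self (by norm_num) _

lemma blockIndex_mono : Monotone blockIndex := fun _ _ h => Nat.log_mono_right (by omega)

lemma blockIndex_add (n : ℕ) (j : Fin (2 ^ n)) : blockIndex (2 ^ n - 1 + j) = n := by
  have := j.2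
  have h1 : 1 ≤ 2 ^ n := Nat.one_le_two_pow
  refine (Nat.log_eq_iff (Or.inr ⟨by norm_num, by omega⟩)).2 ⟨by omega, ?_⟩
  rw [pow_succ]
  omega

/-- The position of `i` in its dyadic block. -/
def blockPos (i : ℕ) : Fin (2 ^ blockIndex i) :=
  ⟨i + 1 - 2 ^ blockIndex i, by
    have := lt_pow_blockIndex_succ i
    rw [pow_succ] at this
    omega⟩

/-- The restriction of a sequence to the dyadic block of index `n`. -/
def blockPart (n : ℕ) (x : ℕ → 𝕜) : Fin (2 ^ n) → 𝕜 := fun j => x (2 ^ n - 1 + j)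

/-- The block diagonal operator on sequences with the flat unitary matrices on the diagonal. -/
def walsh : (ℕ → 𝕜) →ₗ[𝕜] (ℕ → 𝕜) where
  toFun x i := (flatMatrix 𝕜 (blockIndex i) *ᵥ blockPart (blockIndex i) x) (blockPos i)
  map_add' x y := by
    ext i
    exact congrFun (Matrix.mulVec_add _ (blockPart _ x) (blockPart _ y)) _
  map_smul' c x := by
    ext i
    exact congrFun (Matrix.mulVec_smul _ c (blockPart _ x)) _

lemma walsh_apply (x : ℕ → 𝕜) (i : ℕ) :
    walsh x i = (flatMatrix 𝕜 (blockIndex i) *ᵥ blockPart (blockIndex i) x) (blockPos i) := rfl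

lemma blockPart_walsh (n : ℕ) (x : ℕ → 𝕜) :
    blockPart n (walsh x) = flatMatrix 𝕜 n *ᵥ blockPart n x := by
  ext j
  have key : ∀ i, ∀ h : blockIndex i = n, (j : ℕ) = i + 1 - 2 ^ n →
      walsh x i = (flatMatrix 𝕜 n *ᵥ blockPart n x) j := by
    rintro i rfl hj
    rw [walsh_apply]
    congr 1
    exact Fin.ext hj.symm
  have h1 : 1 ≤ 2 ^ n := Nat.one_le_two_pow
  exact key _ (blockIndex_add n j) (by omega)

lemma sum_norm_sq_blockPart_walsh (n : ℕ) (x : ℕ → 𝕜) :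
    ∑ j, ‖blockPart n (walsh x) j‖ ^ 2 = ∑ j, ‖blockPart n x j‖ ^ 2 := by
  rw [blockPart_walsh]
  exact sum_norm_sq_mulVec_of_unitary (flatMatrix_conjTranspose_mul n) _

lemma sum_norm_sq_blockPart_iterate_walsh (m n : ℕ) (x : ℕ → 𝕜) :
    ∑ j, ‖blockPart n ((walsh (𝕜 := 𝕜))^[m] x) j‖ ^ 2 = ∑ j, ‖blockPart n x j‖ ^ 2 := by
  induction m with
  | zero => rfl
  | succ m ih => rw [Function.iterate_succ_apply', sum_norm_sq_blockPart_walsh, ih]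

lemma blockPart_mul (γ : ℕ → 𝕜) (n : ℕ) (x : ℕ → 𝕜) :
    blockPart n (fun i => γ (blockIndex i) * x i) = γ n • blockPart n x := by
  ext j
  simp [blockPart, blockIndex_add]

lemma walsh_mul (γ : ℕ → 𝕜) (x : ℕ → 𝕜) :
    walsh (fun i => γ (blockIndex i) * x i) = fun i => γ (blockIndex i) * walsh x i := by
  ext i
  rw [walsh_apply, walsh_apply, blockPart_mul, Matrix.mulVec_smul]
  rfl

lemma iterate_walsh_mul (m : ℕ) (γ : ℕ → 𝕜) (x : ℕ → 𝕜) :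
    (walsh (𝕜 := 𝕜))^[m] (fun i => γ (blockIndex i) * x i)
      = fun i => γ (blockIndex i) * (walsh (𝕜 := 𝕜))^[m] x i := by
  induction m with
  | zero => rfl
  | succ m ih => rw [Function.iterate_succ_apply', ih, walsh_mul, Function.iterate_succ_apply']

lemma norm_walsh_apply_le (x : ℕ → 𝕜) (i : ℕ) :
    ‖walsh x i‖ ≤ (√(2 ^ blockIndex i))⁻¹ * ∑ j, ‖blockPart (blockIndex i) x j‖ := by
  rw [walsh_apply, Matrix.mulVec, dotProduct, Finset.mul_sum]
  refine (norm_sum_le _ _).trans (Finset.sum_le_sum fun j _ => ?_)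
  rw [norm_mul]
  gcongr
  exact norm_flatMatrix_le _ _ _

lemma sum_range_two_pow_sub_one {M : Type*} [AddCommMonoid M] (f : ℕ → M) (K : ℕ) :
    ∑ i ∈ Finset.range (2 ^ K - 1), f i
      = ∑ n ∈ Finset.range K, ∑ j : Fin (2 ^ n), f (2 ^ n - 1 + j) := by
  induction K with
  | zero => simp
  | succ K ih =>
    have h1 : 1 ≤ 2 ^ K := Nat.one_le_two_pow
    have : 2 ^ (K + 1) - 1 = 2 ^ K - 1 + 2 ^ K := by rw [pow_succ]; omega
    rw [this, Finset.sum_range_add, ih, Finset.sum_range_succ,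
      Finset.sum_range (fun j => f (2 ^ K - 1 + j))]

lemma sum_norm_sq_iterate_walsh_le (m : ℕ) (x : ℕ → 𝕜) {C : ℝ}
    (hC : ∀ s : Finset ℕ, ∑ i ∈ s, ‖x i‖ ^ 2 ≤ C) (s : Finset ℕ) :
    ∑ i ∈ s, ‖(walsh (𝕜 := 𝕜))^[m] x i‖ ^ 2 ≤ C := by
  obtain ⟨K, hK⟩ : ∃ K, s ⊆ Finset.range (2 ^ K - 1) := by
    refine ⟨s.sup id + 2, fun i hi => Finset.mem_range.2 ?_⟩
    have h1 : i ≤ s.sup id := Finset.le_sup (f := id) hi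
    have h2 : s.sup id + 2 < 2 ^ (s.sup id + 2) := Nat.lt_two_pow_self
    omega
  refine (Finset.sum_le_sum_of_subset_of_nonneg hK fun _ _ _ => by positivity).trans ?_
  refine le_trans (le_of_eq ?_) (hC (Finset.range (2 ^ K - 1)))
  rw [sum_range_two_pow_sub_one, sum_range_two_pow_sub_one]
  exact Finset.sum_congr rfl fun n _ => sum_norm_sq_blockPart_iterate_walsh m n x

lemma summable_div_two_pow_blockIndex {f : ℕ → ℝ} (hf : Antitone f) (h0 : ∀ n, 0 ≤ f n)
    (hs : Summable f) : Summable fun i => f (blockIndex i) / 2 ^ blockIndex i := by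
  have h : Summable fun i => f (Nat.log 2 i) / 2 ^ Nat.log 2 i := by
    rw [← summable_condensed_iff_of_nonneg]
    · refine hs.congr fun k => ?_
      rw [Nat.log_pow (by norm_num)]
      field_simp
    · exact fun n => div_nonneg (h0 _) (by positivity)
    · intro a b _ hab
      have hl := Nat.log_mono_right (b := 2) hab
      exact div_le_div₀ (h0 _) (hf hl) (by positivity) (pow_le_pow_right₀ (by norm_num) hl)
  exact (summable_nat_add_iff (f := fun i => f (Nat.log 2 i) / 2 ^ Nat.log 2 i) 1).2 h

end Walsh

section SequenceOperators

variable {𝕜 : Type*} [RCLike 𝕜]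
variable {X : Type*} [NormedAddCommGroup X] [NormedSpace 𝕜 X]

lemma exists_continuousLinearMap_lp {q : ℝ≥0∞} [Fact (1 ≤ q)] (hq : 0 < q.toReal)
    (L : X →ₗ[𝕜] (ℕ → 𝕜)) {C : ℝ} (hC : 0 ≤ C)
    (h : ∀ x, ∀ s : Finset ℕ, ∑ i ∈ s, ‖L x i‖ ^ q.toReal ≤ (C * ‖x‖) ^ q.toReal) :
    ∃ T : X →L[𝕜] lp (fun _ : ℕ => 𝕜) q, (∀ x i, T x i = L x i) ∧ ‖T‖ ≤ C := by
  let T : X →ₗ[𝕜] lp (fun _ : ℕ => 𝕜) q :=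
    { toFun := fun x => ⟨L x, memℓp_gen' (h x)⟩
      map_add' := fun x y => by ext i; exact congrFun (L.map_add x y) i
      map_smul' := fun c x => by ext i; exact congrFun (L.map_smul c x) i }
  refine ⟨T.mkContinuous C fun x => lp.norm_le_of_forall_sum_le hq (by positivity) (h x),
    fun x i => rfl, T.mkContinuous_norm_le hC _⟩

/-- The inclusion of `ℓ_p` into the space of all sequences. -/
def lpCoe (𝕜 : Type*) [RCLike 𝕜] (p : ℝ≥0∞) : lp (fun _ : ℕ => 𝕜) p →ₗ[𝕜] (ℕ → 𝕜) where
  toFun x := x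
  map_add' _ _ := rfl
  map_smul' _ _ := rfl

/-- The diagonal operator on sequences. -/
def diagonalMap (u : ℕ → 𝕜) : (ℕ → 𝕜) →ₗ[𝕜] (ℕ → 𝕜) where
  toFun x i := u i * x i
  map_add' x y := by ext i; simp [mul_add]
  map_smul' c x := by ext i; simp [mul_left_comm]

lemma EllOne.sum_norm_le (x : EllOne 𝕜) (s : Finset ℕ) : ∑ i ∈ s, ‖x i‖ ≤ ‖x‖ := by
  simpa using lp.sum_rpow_le_norm_rpow (p := 1) (by simp) x s

lemma EllTwo.sum_norm_sq_le (x : EllTwo 𝕜) (s : Finset ℕ) : ∑ i ∈ s, ‖x i‖ ^ 2 ≤ ‖x‖ ^ 2 := by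
  simpa using lp.sum_rpow_le_norm_rpow (p := 2) (by simp) x s

lemma sum_blockPart_le_norm (n : ℕ) (x : EllOne 𝕜) : ∑ j, ‖blockPart n x j‖ ≤ ‖x‖ := by
  classical
  have h : Function.Injective fun j : Fin (2 ^ n) => 2 ^ n - 1 + (j : ℕ) := fun a b hab =>
    Fin.ext (Nat.add_left_cancel hab)
  have := EllOne.sum_norm_le x (Finset.univ.map ⟨_, h⟩)
  rwa [Finset.sum_map] at this

/-- The coordinate functionals of `walsh`, normalised on `ℓ_1`. -/
lemma exists_walsh_functional (i : ℕ) :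
    ∃ φ : EllOne 𝕜 →L[𝕜] 𝕜, ‖φ‖ ≤ 1 ∧
      ∀ x, φ x = ((√(2 ^ blockIndex i) : ℝ) : 𝕜) * walsh x i := by
  let L : EllOne 𝕜 →ₗ[𝕜] 𝕜 := ((√(2 ^ blockIndex i) : ℝ) : 𝕜) •
    (LinearMap.proj i ∘ₗ walsh ∘ₗ lpCoe 𝕜 1)
  have hL : ∀ x, L x = ((√(2 ^ blockIndex i) : ℝ) : 𝕜) * walsh x i := fun x => rfl
  refine ⟨L.mkContinuous 1 fun x => ?_, L.mkContinuous_norm_le zero_le_one _, hL⟩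
  have hN : (0 : ℝ) < √(2 ^ blockIndex i) := by positivity
  rw [hL, norm_mul, RCLike.norm_ofReal, abs_of_pos hN, one_mul]
  calc √(2 ^ blockIndex i) * ‖walsh x i‖
      ≤ √(2 ^ blockIndex i) * ((√(2 ^ blockIndex i))⁻¹ * ‖x‖) := by
        gcongr
        refine (norm_walsh_apply_le _ _).trans ?_
        gcongr
        exact sum_blockPart_le_norm _ x
    _ = ‖x‖ := by field_simp

lemma weakTwoNorm_single_lt_top {b : ℕ → 𝕜} (hb : Summable fun i => ‖b i‖ ^ 2) :
    weakTwoNorm 𝕜 (fun i => (lp.single 1 i (b i) : EllOne 𝕜)) < ∞ := by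
  have h1 : ∑' i, ENNReal.ofReal (‖b i‖ ^ 2) ≠ ∞ := hb.tsum_ofReal_ne_top
  refine lt_of_le_of_lt (b := (∑' i, ENNReal.ofReal (‖b i‖ ^ 2)) ^ (1 / 2 : ℝ)) ?_
    (ENNReal.rpow_lt_top_of_nonneg (by norm_num) h1)
  refine iSup₂_le fun y' hy' => ?_
  gcongr with i
  rw [← ofReal_norm, ENNReal.ofReal_rpow_of_nonneg (norm_nonneg _) (by norm_num)]
  refine ENNReal.ofReal_le_ofReal ?_
  rw [Real.rpow_two]
  gcongr
  have h2 := y'.le_of_opNorm_le hy' (lp.single 1 i (b i) : EllOne 𝕜)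
  rwa [lp.norm_single (by simp), one_mul] at h2

lemma exists_isSTwoNuclear {σ : ℝ} (hσ2 : σ ≤ 2) {a b : ℕ → 𝕜}
    {φ : ℕ → EllOne 𝕜 →L[𝕜] 𝕜} (hφ : ∀ i, ‖φ i‖ ≤ 1) (ha : Memℓp a (ENNReal.ofReal σ))
    (hb : Summable fun i => ‖b i‖ ^ 2) :
    ∃ T : EllOne 𝕜 →L[𝕜] EllOne 𝕜, IsSTwoNuclear σ T ∧ ∀ x i, T x i = a i * b i * φ i x := by
  have ha2 : Summable fun i => ‖a i‖ ^ 2 := by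
    have h2 : Memℓp a 2 := ha.of_exponent_ge (by
      rw [← ENNReal.ofReal_ofNat 2]; exact ENNReal.ofReal_le_ofReal hσ2)
    simpa using h2.summable (by simp)
  have hab : Summable fun i => ‖a i * b i‖ := by
    refine Summable.of_nonneg_of_le (fun i => norm_nonneg _) (fun i => ?_) (ha2.add hb)
    rw [norm_mul]
    nlinarith [sq_nonneg (‖a i‖ - ‖b i‖), sq_nonneg ‖a i‖, sq_nonneg ‖b i‖]
  let L : EllOne 𝕜 →ₗ[𝕜] (ℕ → 𝕜) :=
    LinearMap.pi fun i => (a i * b i) • ((φ i : EllOne 𝕜 →L[𝕜] 𝕜) : EllOne 𝕜 →ₗ[𝕜] 𝕜)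
  have hL : ∀ x i, L x i = a i * b i * φ i x := fun x i => rfl
  obtain ⟨T, hT, -⟩ := exists_continuousLinearMap_lp (q := 1) (by simp) L
    (tsum_nonneg fun i => norm_nonneg (a i * b i)) fun x s => by
      simp only [ENNReal.toReal_one, Real.rpow_one, hL, norm_mul (a _ * b _)]
      calc ∑ i ∈ s, ‖a i * b i‖ * ‖φ i x‖ ≤ ∑ i ∈ s, ‖a i * b i‖ * ‖x‖ := by
            gcongr with i
            simpa using (φ i).le_of_opNorm_le (hφ i) x
        _ = (∑ i ∈ s, ‖a i * b i‖) * ‖x‖ := by rw [Finset.sum_mul]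
        _ ≤ _ := by
            gcongr
            exact hab.sum_le_tsum _ fun i _ => norm_nonneg _
  have hsum : ∀ x, HasSum (fun i => (a i * φ i x) • (lp.single 1 i (b i) : EllOne 𝕜)) (T x) := by
    intro x
    have := lp.hasSum_single ENNReal.one_ne_top (T x)
    convert this using 2 with i
    rw [← lp.single_smul, hT, hL, smul_eq_mul]
    congr 1
    ring
  refine ⟨T, ⟨⟨fun i => a i • φ i, fun i => lp.single 1 i (b i), ?_, hsum⟩,
    a, φ, fun i => lp.single 1 i (b i), hφ, ha, weakTwoNorm_single_lt_top hb, hsum⟩,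
    fun x i => by rw [hT, hL]⟩
  refine Summable.of_nonneg_of_le (fun i => by positivity) (fun i => ?_) hab
  rw [lp.norm_single (by simp), norm_smul, norm_mul]
  gcongr
  exact mul_le_of_le_one_right (norm_nonneg _) (hφ i)

lemma exists_diagonal_ellTwo_ellOne {b : ℕ → 𝕜} (hb : Summable fun i => ‖b i‖ ^ 2) :
    ∃ B : EllTwo 𝕜 →L[𝕜] EllOne 𝕜, ∀ x i, B x i = b i * x i := by
  obtain ⟨B, hB, -⟩ := exists_continuousLinearMap_lp (q := 1) (by simp)
    (diagonalMap b ∘ₗ lpCoe 𝕜 2) (Real.sqrt_nonneg (∑' i, ‖b i‖ ^ 2)) fun x s => by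
      simp only [ENNReal.toReal_one, Real.rpow_one]
      calc ∑ i ∈ s, ‖b i * x i‖ = ∑ i ∈ s, ‖b i‖ * ‖x i‖ := by simp only [norm_mul]
        _ ≤ √(∑ i ∈ s, ‖b i‖ ^ 2) * √(∑ i ∈ s, ‖x i‖ ^ 2) := Real.sum_mul_le_sqrt_mul_sqrt _ _ _
        _ ≤ _ := by
            gcongr
            · exact hb.sum_le_tsum _ fun i _ => by positivity
            · exact Real.sqrt_le_iff.2 ⟨norm_nonneg _, EllTwo.sum_norm_sq_le x s⟩
  exact ⟨B, hB⟩

lemma exists_iterate_walsh_ellOne_ellTwo (m : ℕ) :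
    ∃ A : EllOne 𝕜 →L[𝕜] EllTwo 𝕜, ∀ x i, A x i = (walsh (𝕜 := 𝕜))^[m] x i := by
  let L : EllOne 𝕜 →ₗ[𝕜] (ℕ → 𝕜) := ((walsh : Module.End 𝕜 (ℕ → 𝕜)) ^ m) ∘ₗ lpCoe 𝕜 1
  have hL : ∀ x, L x = (walsh (𝕜 := 𝕜))^[m] x := fun x => Module.End.pow_apply _ _ _
  obtain ⟨A, hA, -⟩ := exists_continuousLinearMap_lp (q := 2) (by simp) L zero_le_one fun x s => by
      have h : ∀ s : Finset ℕ, ∑ i ∈ s, ‖x i‖ ^ 2 ≤ ‖x‖ ^ 2 := fun s => by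
        calc ∑ i ∈ s, ‖x i‖ ^ 2 ≤ ∑ i ∈ s, ‖x i‖ * ‖x‖ := by
              refine Finset.sum_le_sum fun i _ => ?_
              rw [sq]
              gcongr
              exact lp.norm_apply_le_norm one_ne_zero x i
          _ ≤ ‖x‖ ^ 2 := by
              rw [← Finset.sum_mul, sq]
              gcongr
              exact EllOne.sum_norm_le x s
      have := sum_norm_sq_iterate_walsh_le m x h s
      simpa [hL] using this
  exact ⟨A, fun x i => by rw [hA, hL]⟩

lemma exists_diagonal_ellTwo {u : ℕ → ℝ} {C : ℝ} (hC : 0 ≤ C) (hu : ∀ i, |u i| ≤ C) :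
    ∃ U : EllTwo 𝕜 →L[𝕜] EllTwo 𝕜, (∀ x i, U x i = (u i : 𝕜) * x i) ∧ ‖U‖ ≤ C := by
  refine exists_continuousLinearMap_lp (q := 2) (by simp)
    (diagonalMap (fun i => (u i : 𝕜)) ∘ₗ lpCoe 𝕜 2) hC fun x s => ?_
  simp only [ENNReal.toReal_ofNat, Real.rpow_two]
  calc ∑ i ∈ s, ‖(u i : 𝕜) * x i‖ ^ 2 ≤ ∑ i ∈ s, C ^ 2 * ‖x i‖ ^ 2 := by
        refine Finset.sum_le_sum fun i _ => ?_
        rw [norm_mul, mul_pow, RCLike.norm_ofReal]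
        gcongr
        exact hu i
    _ ≤ (C * ‖x‖) ^ 2 := by
        rw [← Finset.mul_sum, mul_pow]
        gcongr
        exact EllTwo.sum_norm_sq_le x s

/-- Sequences in `ℓ_2` supported on `{0, …, n - 1}`. -/
def initialSubspace (𝕜 : Type*) [RCLike 𝕜] (n : ℕ) : Submodule 𝕜 (EllTwo 𝕜) where
  carrier := {x | ∀ i, n ≤ i → x i = 0}
  add_mem' {x y} hx hy i hi := by
    rw [lp.coeFn_add, Pi.add_apply, hx i hi, hy i hi, add_zero]
  zero_mem' _ _ := rfl
  smul_mem' c x hx i hi := by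
    rw [lp.coeFn_smul, Pi.smul_apply, hx i hi, smul_zero]

/-- The first `n` coordinates of an element of `initialSubspace`. -/
def initialCoords (n : ℕ) : initialSubspace 𝕜 n →ₗ[𝕜] (Fin n → 𝕜) where
  toFun x i := (x : EllTwo 𝕜) i
  map_add' _ _ := rfl
  map_smul' _ _ := rfl

lemma initialCoords_injective (n : ℕ) :
    Function.Injective (initialCoords (𝕜 := 𝕜) n) := by
  intro x y hxy
  apply Subtype.ext
  ext i
  rcases lt_or_ge i n with hi | hi
  · exact congrFun hxy ⟨i, hi⟩
  · rw [x.2 i hi, y.2 i hi]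

lemma rank_initialSubspace_le (n : ℕ) : Module.rank 𝕜 (initialSubspace 𝕜 n) ≤ n := by
  have := LinearMap.rank_le_of_injective _ (initialCoords_injective (𝕜 := 𝕜) n)
  simpa using this

instance (n : ℕ) : FiniteDimensional 𝕜 (initialSubspace 𝕜 n) :=
  Module.rank_lt_aleph0_iff.1 ((rank_initialSubspace_le n).trans_lt (Cardinal.natCast_lt_aleph0))

variable {u : ℕ → ℝ} {U : EllTwo 𝕜 →L[𝕜] EllTwo 𝕜}

lemma isCompactOperator_of_mem_initialSubspace {n : ℕ} (hU : ∀ x, U x ∈ initialSubspace 𝕜 n) :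
    IsCompactOperator U := by
  have : ProperSpace (initialSubspace 𝕜 n) := FiniteDimensional.proper_rclike 𝕜 _
  exact (isCompactOperator_of_locallyCompactSpace_dom (U.codRestrict _ hU)).clm_comp
    (initialSubspace 𝕜 n).subtypeL

lemma isCompactOperator_diagonal (hU : ∀ x i, U x i = (u i : 𝕜) * x i)
    (hu : Filter.Tendsto u Filter.atTop (nhds 0)) : IsCompactOperator U := by
  obtain ⟨C, hC⟩ := hu.abs.bddAbove_range
  have hC' : ∀ i, |u i| ≤ C := fun i => hC ⟨i, rfl⟩
  have hC0 : 0 ≤ C := (abs_nonneg _).trans (hC' 0)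
  have hF : ∀ n, ∃ F : EllTwo 𝕜 →L[𝕜] EllTwo 𝕜,
      (∀ x i, F x i = ((if i < n then u i else 0 : ℝ) : 𝕜) * x i) ∧ ‖F‖ ≤ C := fun n =>
    exists_diagonal_ellTwo hC0 fun i => by
      split_ifs
      · exact hC' i
      · simpa using hC0
  choose F hF _ using hF
  refine isCompactOperator_of_tendsto (l := Filter.atTop) (F := F) ?_
    (Filter.Eventually.of_forall fun n => ?_)
  · rw [tendsto_iff_norm_sub_tendsto_zero, Metric.tendsto_atTop]
    intro ε hε
    obtain ⟨n₀, hn₀⟩ := Metric.tendsto_atTop.1 hu (ε / 2) (by positivity)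
    refine ⟨n₀, fun n hn => ?_⟩
    obtain ⟨V, hV, hVn⟩ := exists_diagonal_ellTwo (𝕜 := 𝕜)
      (u := fun i => if i < n then 0 else - u i) (half_pos hε).le fun i => by
        split_ifs with h
        · simpa using (half_pos hε).le
        · rw [abs_neg]
          simpa using (hn₀ i (by omega)).le
    have : F n - U = V := by
      ext x i
      change F n x i - U x i = V x i
      rw [hF, hU, hV, ← sub_mul]
      split_ifs <;> simp
    rw [this, Real.dist_0_eq_abs, abs_norm]
    linarith
  · refine isCompactOperator_of_mem_initialSubspace (n := n) fun x i hi => ?_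
    rw [hF, if_neg (by omega)]
    simp

lemma singularNumber_diagonal_le (hU : ∀ x i, U x i = (u i : 𝕜) * x i) (hu : Antitone u)
    (h0 : ∀ i, 0 ≤ u i) (n : ℕ) : singularNumber U n ≤ u n := by
  refine singularNumber_le (h0 n) ((Submodule.rank_mono ?_).trans (rank_initialSubspace_le n))
  refine iSup₂_le fun l hl x hx i hi => ?_
  have hx' : (ContinuousLinearMap.adjoint U ∘L U) x = ((l ^ 2 : ℝ) : 𝕜) • x :=
    Module.End.mem_eigenspace_iff.1 hx
  have h2 := inner_adjoint_comp_self U x (lp.single 2 i (1 : 𝕜))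
  rw [hx'] at h2
  have hs : U (lp.single 2 i (1 : 𝕜)) = lp.single 2 i (u i : 𝕜) := by
    ext j
    rw [hU, lp.single_apply, lp.single_apply]
    rcases eq_or_ne j i with rfl | hj
    · simp
    · simp [hj]
  rw [hs, lp.inner_single_right, lp.inner_single_right, lp.coeFn_smul, Pi.smul_apply, hU] at h2
  have hul : u i ^ 2 < l ^ 2 :=
    pow_lt_pow_left₀ ((hu hi).trans_lt hl) (h0 i) two_ne_zero
  have h3 : (((l ^ 2 - u i ^ 2 : ℝ)) : 𝕜) * x i = 0 := by
    simp only [RCLike.inner_apply, smul_eq_mul, map_mul, RCLike.conj_ofReal, one_mul] at h2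
    have h4 := congrArg (starRingEnd 𝕜) h2
    simp only [map_mul, RCLike.conj_ofReal, RCLike.conj_conj] at h4
    push_cast at h4 ⊢
    linear_combination h4
  have h5 : (((l ^ 2 - u i ^ 2 : ℝ)) : 𝕜) ≠ 0 := by
    exact_mod_cast (sub_pos.2 hul).ne'
  exact (mul_eq_zero.1 h3).resolve_left h5

lemma isSchatten_diagonal {s : ℝ≥0∞} (hU : ∀ x i, U x i = (u i : 𝕜) * x i) (hu : Antitone u)
    (h0 : ∀ i, 0 ≤ u i) (hlim : Filter.Tendsto u Filter.atTop (nhds 0)) (hs : Memℓp u s) :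
    IsSchatten s U :=
  ⟨isCompactOperator_diagonal hU hlim, hs.mono fun i => by
    rw [Real.norm_of_nonneg (singularNumber_nonneg U i)]
    exact singularNumber_diagonal_le hU hu h0 i⟩

end SequenceOperators

section Weights

/-- The weight `2 ^ (-n p) (n + 1) ^ (-q)`. -/
def weight (p q : ℝ) (n : ℕ) : ℝ := ((2 : ℝ) ^ n) ^ (-p) * ((n : ℝ) + 1) ^ (-q)

lemma weight_pos (p q : ℝ) (n : ℕ) : 0 < weight p q n := by unfold weight; positivity

lemma weight_mul (p q p' q' : ℝ) (n : ℕ) :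
    weight p q n * weight p' q' n = weight (p + p') (q + q') n := by
  unfold weight
  rw [neg_add, neg_add, Real.rpow_add (by positivity), Real.rpow_add (by positivity)]
  ring

lemma weight_zero (n : ℕ) : weight 0 0 n = 1 := by simp [weight]

lemma prod_weight {ι : Type*} (s : Finset ι) (p q : ι → ℝ) (n : ℕ) :
    ∏ k ∈ s, weight (p k) (q k) n = weight (∑ k ∈ s, p k) (∑ k ∈ s, q k) n := by
  classical
  induction s using Finset.induction_on with
  | empty => simp [weight_zero]
  | insert a s ha ih => rw [Finset.prod_insert ha, Finset.sum_insert ha, Finset.sum_insert ha, ih,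
      weight_mul]

lemma weight_rpow (p q t : ℝ) (n : ℕ) : weight p q n ^ t = weight (p * t) (q * t) n := by
  unfold weight
  rw [Real.mul_rpow (by positivity) (by positivity), ← Real.rpow_mul (by positivity),
    ← Real.rpow_mul (by positivity), neg_mul, neg_mul]

lemma sqrt_two_pow_eq_weight (n : ℕ) : √(2 ^ n) = weight (-(1 / 2)) 0 n := by
  rw [weight, neg_neg, Real.sqrt_eq_rpow, neg_zero, Real.rpow_zero, mul_one]

lemma weight_antitone {p q : ℝ} (hp : 0 ≤ p) (hq : 0 ≤ q) : Antitone (weight p q) := by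
  intro a b hab
  have hab' : (a : ℝ) ≤ b := by exact_mod_cast hab
  unfold weight
  gcongr ?_ * ?_
  · exact Real.rpow_le_rpow_of_nonpos (by positivity)
      (pow_le_pow_right₀ (by norm_num) hab) (by linarith)
  · exact Real.rpow_le_rpow_of_nonpos (by positivity) (by linarith) (by linarith)

lemma summable_weight_blockIndex {q : ℝ} (hq : 1 < q) :
    Summable fun i => weight 1 q (blockIndex i) := by
  have h0 : Antitone fun n : ℕ => ((n : ℝ) + 1) ^ (-q) := by
    intro a b hab
    have hab' : (a : ℝ) ≤ b := by exact_mod_cast hab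
    exact Real.rpow_le_rpow_of_nonpos (by positivity) (by linarith) (by linarith)
  have h1 : Summable fun n : ℕ => ((n : ℝ) + 1) ^ (-q) := by
    have := (summable_nat_add_iff (f := fun n : ℕ => (n : ℝ) ^ (-q)) 1).2
      (Real.summable_nat_rpow.2 (by linarith))
    simpa using this
  refine (summable_div_two_pow_blockIndex h0 (fun n => by positivity) h1).congr fun i => ?_
  rw [weight, Real.rpow_neg_one, div_eq_inv_mul]

lemma summable_weight_rpow {p q t : ℝ} (hp : p * t = 1) (hq : 1 < q * t) :
    Summable fun i => weight p q (blockIndex i) ^ t := by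
  simp only [weight_rpow, hp]
  exact summable_weight_blockIndex hq

lemma tendsto_blockIndex : Filter.Tendsto blockIndex Filter.atTop Filter.atTop := by
  refine Filter.tendsto_atTop_atTop_of_monotone blockIndex_mono fun n => ⟨2 ^ n, ?_⟩
  exact Nat.le_log_of_pow_le (by norm_num) (by omega)

lemma tendsto_weight {p q : ℝ} (hp : 0 ≤ p) (hq : 0 < q) :
    Filter.Tendsto (weight p q) Filter.atTop (nhds 0) := by
  have h1 : Filter.Tendsto (fun n : ℕ => ((n : ℝ) + 1) ^ (-q)) Filter.atTop (nhds 0) :=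
    (tendsto_rpow_neg_atTop hq).comp
      (Filter.tendsto_atTop_add_const_right _ 1 tendsto_natCast_atTop_atTop)
  refine squeeze_zero (fun n => (weight_pos p q n).le) (fun n => ?_) h1
  refine mul_le_of_le_one_left (by positivity) ?_
  exact Real.rpow_le_one_of_one_le_of_nonpos (one_le_pow₀ (by norm_num)) (by linarith)

lemma not_forall_weight_le {θ : ℝ} (hθ : 0 < θ) (Q D : ℝ) :
    ¬ ∀ k : ℕ, weight (-θ) Q k ≤ D := by
  intro h
  have hD : 0 < D := (weight_pos _ _ 0).trans_le (h 0)
  have hb : 0 < θ * Real.log 2 := mul_pos hθ (Real.log_pos (by norm_num))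
  have hlim := (tendsto_rpow_mul_exp_neg_mul_atTop_nhds_zero Q _ hb).comp
    (Filter.tendsto_atTop_add_const_right _ (1 : ℝ) (tendsto_natCast_atTop_atTop (R := ℝ)))
  obtain ⟨k, hk⟩ := (hlim.eventually_lt_const
    (show (0 : ℝ) < D⁻¹ * Real.exp (-(θ * Real.log 2)) by positivity)).exists
  simp only [Function.comp_apply] at hk
  have hw : weight (-θ) Q k * (((k : ℝ) + 1) ^ Q * Real.exp (-(θ * Real.log 2) * ((k : ℝ) + 1)))
      = Real.exp (-(θ * Real.log 2)) := by
    have h1 : ((2 : ℝ) ^ k) ^ θ = Real.exp (θ * Real.log 2 * k) := by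
      rw [Real.rpow_def_of_pos (by positivity), Real.log_pow]
      ring_nf
    rw [weight, neg_neg, h1, Real.rpow_neg (by positivity)]
    have h2 : ((k : ℝ) + 1) ^ Q ≠ 0 := (by positivity : 0 < ((k : ℝ) + 1) ^ Q).ne'
    field_simp
    rw [← Real.exp_add]
    ring_nf
  have h3 := mul_lt_mul_of_pos_left hk (weight_pos (-θ) Q k)
  rw [hw] at h3
  have h4 : weight (-θ) Q k * (D⁻¹ * Real.exp (-(θ * Real.log 2)))
      ≤ D * (D⁻¹ * Real.exp (-(θ * Real.log 2))) := by
    gcongr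
    exact h k
  rw [mul_inv_cancel_left₀ hD.ne'] at h4
  linarith

end Weights

section Operators

variable {𝕜 : Type*} [RCLike 𝕜]

/-- A block diagonal `(σ;2)`-nuclear operator on `ℓ_1`, a weighted version of `walsh`. -/
lemma exists_isSTwoNuclear_walsh (𝕜 : Type*) [RCLike 𝕜] {σ : ℝ} (hσ : 0 < σ) (hσ2 : σ ≤ 2) :
    ∃ T : EllOne 𝕜 →L[𝕜] EllOne 𝕜, IsSTwoNuclear σ T ∧
      ∀ x i, T x i = (weight (1 / σ) (2 / σ + 1) (blockIndex i) : 𝕜) * walsh x i := by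
  choose φ hφ hφx using exists_walsh_functional (𝕜 := 𝕜)
  obtain ⟨T, hT, hTx⟩ := exists_isSTwoNuclear (𝕜 := 𝕜) hσ2
    (a := fun i => (weight (1 / σ) (2 / σ) (blockIndex i) : 𝕜))
    (b := fun i => (weight (1 / 2) 1 (blockIndex i) : 𝕜)) hφ
    (by
      refine (memℓp_gen_iff (by rwa [ENNReal.toReal_ofReal hσ.le])).2 ?_
      simp only [ENNReal.toReal_ofReal hσ.le, RCLike.norm_ofReal, abs_of_pos (weight_pos _ _ _)]
      exact summable_weight_rpow (by field_simp) (by field_simp; norm_num))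
    (by
      simp only [RCLike.norm_ofReal, abs_of_pos (weight_pos _ _ _), ← Real.rpow_two]
      exact summable_weight_rpow (by norm_num) (by norm_num))
  refine ⟨T, hT, fun x i => ?_⟩
  rw [hTx, hφx, ← mul_assoc, ← RCLike.ofReal_mul, ← RCLike.ofReal_mul, sqrt_two_pow_eq_weight,
    weight_mul, weight_mul]
  congr 3 <;> ring

lemma list_prod_walsh_apply {m : ℕ} (T : Fin m → (EllOne 𝕜 →L[𝕜] EllOne 𝕜)) (γ : Fin m → ℕ → 𝕜)
    (hT : ∀ k x i, T k x i = γ k (blockIndex i) * walsh x i) (x : EllOne 𝕜) (i : ℕ) :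
    (List.ofFn T).reverse.prod x i
      = (∏ k, γ k (blockIndex i)) * (walsh (𝕜 := 𝕜))^[m] x i := by
  induction m generalizing x with
  | zero => simp
  | succ m ih =>
    have h0 : (T 0 x : ℕ → 𝕜) = fun i => γ 0 (blockIndex i) * walsh x i := funext (hT 0 x)
    rw [List.ofFn_succ, List.reverse_cons, List.prod_append, List.prod_singleton,
      mul_apply_eq_comp, ih (fun k => T k.succ) (fun k => γ k.succ)
        (fun k => hT k.succ), h0, iterate_walsh_mul, Fin.prod_univ_succ,
      Function.iterate_succ_apply]
    ring

/-- The embedding of the dyadic block of index `n` into `ℓ_1`. -/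
def blockEmbed (n : ℕ) : EuclideanSpace 𝕜 (Fin (2 ^ n)) →ₗ[𝕜] EllOne 𝕜 where
  toFun k := ∑ j : Fin (2 ^ n), lp.single 1 (2 ^ n - 1 + (j : ℕ)) (k j)
  map_add' k l := by simp [Finset.sum_add_distrib]
  map_smul' c k := by
    simp only [PiLp.smul_apply, lp.single_smul, Finset.smul_sum, RingHom.id_apply]

lemma blockPart_blockEmbed (n : ℕ) (k : EuclideanSpace 𝕜 (Fin (2 ^ n))) :
    blockPart n (blockEmbed n k : EllOne 𝕜) = k := by
  ext j
  change (∑ j : Fin (2 ^ n), lp.single 1 (2 ^ n - 1 + (j : ℕ)) (k j) : EllOne 𝕜) (2 ^ n - 1 + (j : ℕ)) = k j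
  rw [lp.coeFn_sum, Finset.sum_apply, Finset.sum_eq_single j]
  · simp
  · intro l _ hl
    refine lp.single_apply_ne _ _ _ fun h => hl (Fin.ext ?_)
    omega
  · simp

lemma norm_blockEmbed_basisFun (n : ℕ) (j : Fin (2 ^ n)) :
    ‖blockEmbed n (EuclideanSpace.basisFun (Fin (2 ^ n)) 𝕜 j)‖ = 1 := by
  have : blockEmbed n (EuclideanSpace.basisFun (Fin (2 ^ n)) 𝕜 j)
      = (lp.single 1 (2 ^ n - 1 + (j : ℕ)) 1 : EllOne 𝕜) := by
    change ∑ l : Fin (2 ^ n), (lp.single 1 (2 ^ n - 1 + (l : ℕ))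
      ((EuclideanSpace.basisFun (Fin (2 ^ n)) 𝕜 j) l) : EllOne 𝕜) = _
    rw [Finset.sum_eq_single j]
    · simp
    · intro l _ hl
      simp [hl]
    · simp
  rw [this, lp.norm_single (by simp), norm_one]

/-- The restriction of elements of `ℓ_1` to the dyadic block of index `n`. -/
def blockProj (n : ℕ) : EllOne 𝕜 →L[𝕜] EuclideanSpace 𝕜 (Fin (2 ^ n)) :=
  ((EuclideanSpace.equiv (Fin (2 ^ n)) 𝕜).symm : (Fin (2 ^ n) → 𝕜) →L[𝕜] _) ∘L
    ContinuousLinearMap.pi fun j => lp.evalCLM 𝕜 (fun _ : ℕ => 𝕜) 1 (2 ^ n - 1 + (j : ℕ))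

lemma blockProj_apply (n : ℕ) (x : EllOne 𝕜) (j : Fin (2 ^ n)) :
    blockProj n x j = blockPart n x j := rfl

variable {H : Type*} [NormedAddCommGroup H] [InnerProductSpace 𝕜 H] [CompleteSpace H]

/-- An operator from a Hilbert space to `ℓ_1` has Hilbert-Schmidt norm at most its norm. -/
lemma sum_norm_sq_adjoint_blockProj_le (n : ℕ) (B : H →L[𝕜] EllOne 𝕜) :
    ∑ j, ‖ContinuousLinearMap.adjoint (blockProj n ∘L B)
      (EuclideanSpace.basisFun (Fin (2 ^ n)) 𝕜 j)‖ ^ 2 ≤ ‖B‖ ^ 2 := by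
  set B' := ContinuousLinearMap.adjoint (blockProj n ∘L B)
  obtain ⟨ε, hε, hs⟩ := exists_sign_sum_norm_sq_le (𝕜 := 𝕜) Finset.univ
    fun j => B' (EuclideanSpace.basisFun (Fin (2 ^ n)) 𝕜 j)
  refine hs.trans ?_
  simp only [← map_smul, ← map_sum]
  set e : EuclideanSpace 𝕜 (Fin (2 ^ n)) := ∑ j, ε j • EuclideanSpace.basisFun (Fin (2 ^ n)) 𝕜 j
  have he : ∀ j, e j = ε j := by
    intro j
    simp [e, Finset.sum_apply, Pi.single_apply]
  have h1 : ‖B' e‖ * ‖B' e‖ ≤ ‖B‖ * ‖B' e‖ := by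
    have h2 : inner 𝕜 (B' e) (B' e) = inner 𝕜 e (blockProj n (B (B' e))) :=
      ContinuousLinearMap.adjoint_inner_left _ _ _
    have h3 : ‖B' e‖ * ‖B' e‖ = ‖inner 𝕜 e (blockProj n (B (B' e)))‖ := by
      rw [← h2, inner_self_eq_norm_sq_to_K, norm_pow, RCLike.norm_ofReal, abs_norm, sq]
    rw [h3, PiLp.inner_apply]
    refine (norm_sum_le _ _).trans (le_trans ?_ (B.le_opNorm _))
    refine le_trans (Finset.sum_le_sum fun j _ => ?_) (sum_blockPart_le_norm n (B (B' e)))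
    refine (norm_inner_le_norm _ _).trans ?_
    rw [he, hε, one_mul, blockProj_apply]
  gcongr
  rcases (norm_nonneg (B' e)).eq_or_lt with h | h
  · rw [← h]
    exact norm_nonneg _
  · exact le_of_mul_le_mul_right h1 h

lemma norm_blockProj_walsh {m : ℕ} {T : EllOne 𝕜 →L[𝕜] EllOne 𝕜} {γ : ℕ → ℝ}
    (hγ : ∀ n, 0 ≤ γ n)
    (hT : ∀ x i, T x i = (γ (blockIndex i) : 𝕜) * (walsh (𝕜 := 𝕜))^[m] x i) (n : ℕ)
    (k : EuclideanSpace 𝕜 (Fin (2 ^ n))) :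
    ‖blockProj n (T (blockEmbed n k))‖ = γ n * ‖k‖ := by
  have h1 : blockPart n (T (blockEmbed n k))
      = (γ n : 𝕜) • blockPart n ((walsh (𝕜 := 𝕜))^[m] (blockEmbed n k : EllOne 𝕜)) := by
    rw [← blockPart_mul (fun n => (γ n : 𝕜))]
    exact congrArg _ (funext (hT _))
  rw [EuclideanSpace.norm_eq, EuclideanSpace.norm_eq]
  simp only [blockProj_apply, h1, Pi.smul_apply, norm_smul, mul_pow]
  rw [← Finset.mul_sum, sum_norm_sq_blockPart_iterate_walsh, blockPart_blockEmbed,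
    Real.sqrt_mul (by positivity), RCLike.norm_ofReal, abs_of_nonneg (hγ n), Real.sqrt_sq (hγ n)]

lemma not_factorsThroughSchatten_walsh {m : ℕ} {α Q : ℝ} {T : EllOne 𝕜 →L[𝕜] EllOne 𝕜}
    (hT : ∀ x i, T x i = (weight α Q (blockIndex i) : 𝕜) * (walsh (𝕜 := 𝕜))^[m] x i)
    {t : ℝ≥0∞} (ht : 0 < t.toReal) (hα : α - 1 / 2 < 1 / t.toReal) :
    ¬ FactorsThroughSchatten H t T := by
  rintro ⟨A, U, B, ⟨hU, hUt⟩, hTe⟩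
  obtain ⟨C, hC, hCn⟩ := exists_singularNumber_le_rpow ht hUt
  set τ := 1 / t.toReal
  have hτ : 0 < τ := by positivity
  have key : ∀ k : ℕ, (2 : ℝ) ^ k * weight α Q (k + 1)
      ≤ 2 * C * ((2 : ℝ) ^ k) ^ (-τ) * (‖B‖ * (√(2 ^ (k + 1)) * ‖A‖)) := by
    intro k
    have hx : (0 : ℝ) < (2 : ℝ) ^ k := by positivity
    set ρ := 2 * C * ((2 : ℝ) ^ k) ^ (-τ) with hρ
    have hr : singularNumber U (2 ^ k) < ρ := by
      have h1 := hCn (2 ^ k)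
      push_cast at h1
      have h2 : ((2 : ℝ) ^ k + 1) ^ (-τ) ≤ ((2 : ℝ) ^ k) ^ (-τ) :=
        Real.rpow_le_rpow_of_nonpos hx (by linarith) (by linarith)
      have h3 : 0 < ((2 : ℝ) ^ k) ^ (-τ) := by positivity
      have h4 := mul_le_mul_of_nonneg_left h2 hC.le
      have h5 := mul_pos hC h3
      rw [hρ]
      linarith
    have hA : ∑ j, ‖(A ∘L LinearMap.toContinuousLinearMap (blockEmbed (k + 1)) :
        EuclideanSpace 𝕜 (Fin (2 ^ (k + 1))) →L[𝕜] H)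
          (EuclideanSpace.basisFun (Fin (2 ^ (k + 1))) 𝕜 j)‖ ^ 2
          ≤ (√(2 ^ (k + 1)) * ‖A‖) ^ 2 := by
      calc _ ≤ ∑ j : Fin (2 ^ (k + 1)), ‖A‖ ^ 2 := by
            refine Finset.sum_le_sum fun j _ => ?_
            gcongr
            have := A.le_opNorm (blockEmbed (k + 1)
              (EuclideanSpace.basisFun (Fin (2 ^ (k + 1))) 𝕜 j))
            rwa [norm_blockEmbed_basisFun, mul_one] at this
        _ = _ := by
            rw [mul_pow, Real.sq_sqrt (by positivity)]
            simp
    have h := sub_mul_le_of_comp_isometry (EuclideanSpace.basisFun (Fin (2 ^ (k + 1))) 𝕜)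
      (A ∘L LinearMap.toContinuousLinearMap (blockEmbed (k + 1))) U hU (blockProj (k + 1) ∘L B)
      (ContinuousLinearMap.adjoint (blockProj (k + 1) ∘L B))
      (fun x y => (ContinuousLinearMap.adjoint_inner_left _ _ _).symm)
      (weight_pos α Q (k + 1)) (by positivity : 0 ≤ ρ)
      (by positivity : 0 ≤ √(2 ^ (k + 1)) * ‖A‖) (norm_nonneg B) (rank_singularSpace_le hr)
      (fun l => by
        have := norm_blockProj_walsh (fun n => (weight_pos α Q n).le) hT (k + 1) l
        rw [hTe] at this
        exact this) hA (sum_norm_sq_adjoint_blockProj_le (k + 1) B)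
    have hcard : ((Fintype.card (Fin (2 ^ (k + 1))) : ℝ) - ((2 ^ k : ℕ) : ℝ)) = 2 ^ k := by
      rw [Fintype.card_fin]
      push_cast
      ring
    rwa [hcard] at h
  refine not_forall_weight_le (θ := 1 / 2 - α + τ) (by linarith) Q
    (2 * C * ‖B‖ * ‖A‖ * √2 * 2 ^ α * 2 ^ |Q|) fun k => ?_
  have hx : (0 : ℝ) < (2 : ℝ) ^ k := by positivity
  have h := key k
  have hw : weight α Q (k + 1) = 2 ^ (-α) * ((2 : ℝ) ^ k) ^ (-α) * ((k : ℝ) + 2) ^ (-Q) := by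
    rw [weight, pow_succ, Real.mul_rpow hx.le (by norm_num)]
    push_cast
    rw [show (k : ℝ) + 1 + 1 = k + 2 by ring]
    ring
  have hsq : √((2 : ℝ) ^ (k + 1)) = √2 * ((2 : ℝ) ^ k) ^ (1 / 2 : ℝ) := by
    rw [pow_succ, mul_comm, Real.sqrt_mul (by norm_num), Real.sqrt_eq_rpow (2 ^ k)]
  have hk : ((k : ℝ) + 1) ^ (-Q) ≤ 2 ^ |Q| * ((k : ℝ) + 2) ^ (-Q) := by
    have hk1 : (0 : ℝ) < (k : ℝ) + 1 := by positivity
    have hk2 : (0 : ℝ) < (k : ℝ) + 2 := by positivity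
    rw [← div_le_iff₀ (by positivity), ← Real.div_rpow hk1.le hk2.le,
      Real.rpow_neg (by positivity), ← Real.inv_rpow (by positivity), inv_div]
    refine (Real.rpow_le_rpow_of_exponent_le ?_ (le_abs_self Q)).trans
      (Real.rpow_le_rpow (by positivity) ?_ (abs_nonneg _))
    · rw [le_div_iff₀ hk1]; linarith
    · rw [div_le_iff₀ hk1]; nlinarith [(Nat.cast_nonneg k : (0 : ℝ) ≤ k)]
  rw [hw, hsq] at h
  set x := (2 : ℝ) ^ k
  have e1 : weight (-(1 / 2 - α + τ)) Q k
      = x ^ (-(1 / 2 : ℝ)) * (x * x ^ (-α)) * x ^ τ * ((k : ℝ) + 1) ^ (-Q) := by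
    rw [weight, neg_neg]
    congr 1
    rw [show x * x ^ (-α) = x ^ (1 - α) by rw [sub_eq_add_neg, Real.rpow_add hx, Real.rpow_one],
      ← Real.rpow_add hx, ← Real.rpow_add hx]
    congr 1
    ring
  have e2 : x ^ (-(1 / 2 : ℝ)) * x ^ (1 / 2 : ℝ) = 1 := by
    rw [← Real.rpow_add hx, neg_add_cancel, Real.rpow_zero]
  have e3 : x ^ τ * x ^ (-τ) = 1 := by rw [← Real.rpow_add hx, add_neg_cancel, Real.rpow_zero]
  have e4 : (2 : ℝ) ^ α * 2 ^ (-α) = 1 := by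
    rw [← Real.rpow_add (by norm_num), add_neg_cancel, Real.rpow_zero]
  calc weight (-(1 / 2 - α + τ)) Q k
      ≤ x ^ (-(1 / 2 : ℝ)) * (x * x ^ (-α)) * x ^ τ * (2 ^ |Q| * ((k : ℝ) + 2) ^ (-Q)) := by
        rw [e1]
        gcongr
    _ = (2 ^ α * 2 ^ (-α)) * x ^ (-(1 / 2 : ℝ)) * (x * x ^ (-α)) * x ^ τ *
          (2 ^ |Q| * ((k : ℝ) + 2) ^ (-Q)) := by rw [e4, one_mul]
    _ = 2 ^ α * x ^ (-(1 / 2 : ℝ)) * x ^ τ * 2 ^ |Q| *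
          (x * (2 ^ (-α) * x ^ (-α) * ((k : ℝ) + 2) ^ (-Q))) := by ring
    _ ≤ 2 ^ α * x ^ (-(1 / 2 : ℝ)) * x ^ τ * 2 ^ |Q| *
          (2 * C * x ^ (-τ) * (‖B‖ * (√2 * x ^ (1 / 2 : ℝ) * ‖A‖))) := by gcongr
    _ = 2 * C * ‖B‖ * ‖A‖ * √2 * 2 ^ α * 2 ^ |Q| * (x ^ (-(1 / 2 : ℝ)) * x ^ (1 / 2 : ℝ)) *
          (x ^ τ * x ^ (-τ)) := by ring
    _ = _ := by rw [e2, e3, mul_one, mul_one]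

lemma factorsThroughSchatten_walsh {m : ℕ} {α Q : ℝ} {T : EllOne 𝕜 →L[𝕜] EllOne 𝕜}
    (hT : ∀ x i, T x i = (weight α Q (blockIndex i) : 𝕜) * (walsh (𝕜 := 𝕜))^[m] x i)
    {s : ℝ≥0∞} (hα : 1 / 2 ≤ α) (hQ : 2 * α ≤ Q - 1)
    (hs : s⁻¹ = ENNReal.ofReal (α - 1 / 2)) : FactorsThroughSchatten (EllTwo 𝕜) s T := by
  obtain ⟨A, hA⟩ := exists_iterate_walsh_ellOne_ellTwo (𝕜 := 𝕜) m
  obtain ⟨B, hB⟩ := exists_diagonal_ellTwo_ellOne (𝕜 := 𝕜)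
    (b := fun i => (weight (1 / 2) 1 (blockIndex i) : 𝕜)) (by
      simp only [RCLike.norm_ofReal, abs_of_pos (weight_pos _ _ _), ← Real.rpow_two]
      exact summable_weight_rpow (by norm_num) (by norm_num))
  set u : ℕ → ℝ := fun i => weight (α - 1 / 2) (Q - 1) (blockIndex i)
  have hu : Antitone u :=
    (weight_antitone (by linarith) (by linarith)).comp_monotone blockIndex_mono
  have hu0 : ∀ i, 0 ≤ u i := fun i => (weight_pos _ _ _).le
  have hu1 : ∀ i, |u i| ≤ u 0 := fun i => by
    rw [abs_of_nonneg (hu0 i)]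
    exact hu (Nat.zero_le i)
  have hlim : Filter.Tendsto u Filter.atTop (nhds 0) :=
    (tendsto_weight (by linarith) (by linarith)).comp tendsto_blockIndex
  obtain ⟨U, hU, -⟩ := exists_diagonal_ellTwo (𝕜 := 𝕜) (hu0 0) hu1
  have hmem : Memℓp u s := by
    rcases eq_or_ne s ∞ with rfl | hs'
    · exact memℓp_infty ⟨u 0, by rintro _ ⟨i, rfl⟩; exact hu1 i⟩
    · have h1 : s.toReal⁻¹ = α - 1 / 2 := by
        rw [← ENNReal.toReal_inv, hs, ENNReal.toReal_ofReal (by linarith)]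
      have hs0 : s ≠ 0 := by
        rintro rfl
        simp at hs
      have h2 : 0 < s.toReal := ENNReal.toReal_pos hs0 hs'
      refine (memℓp_gen_iff h2).2 ?_
      simp only [Real.norm_of_nonneg (hu0 _)]
      have h3 : (α - 1 / 2) * s.toReal = 1 := by rw [← h1, inv_mul_cancel₀ h2.ne']
      exact summable_weight_rpow h3 (by nlinarith)
  refine ⟨A, U, B, isSchatten_diagonal hU hu hu0 hlim hmem, ?_⟩
  ext x i
  change T x i = B (U (A x)) i
  rw [hT, hB, hU, hA, ← mul_assoc, ← RCLike.ofReal_mul, weight_mul]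
  congr 3 <;> ring

end Operators

end

theorem mainTheorem11 (𝕜 : Type*) [RCLike 𝕜] (m : ℕ) (hm : 1 ≤ m)
    (σ : Fin m → ℝ) (hσ : ∀ k, 0 < σ k ∧ σ k ≤ 2)
    (s : ℝ≥0∞) (hs : s⁻¹ = ENNReal.ofReal ((∑ k, 1 / σ k) - 1 / 2)) :
    ∃ T : Fin m → (EllOne 𝕜 →L[𝕜] EllOne 𝕜),
      (∀ k, IsSTwoNuclear (σ k) (T k)) ∧
      FactorsThroughSchatten (EllTwo 𝕜) s (List.ofFn T).reverse.prod ∧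
      ∀ t : ℝ≥0∞, 0 < t → t < s →
        ∀ (H : Type*) [NormedAddCommGroup H] [InnerProductSpace 𝕜 H] [CompleteSpace H],
          ¬ FactorsThroughSchatten H t (List.ofFn T).reverse.prod := by
  choose T hTn hT using fun k => exists_isSTwoNuclear_walsh 𝕜 (hσ k).1 (hσ k).2
  have hprod : ∀ x i, (List.ofFn T).reverse.prod x i
      = (weight (∑ k, 1 / σ k) (∑ k, (2 / σ k + 1)) (blockIndex i) : 𝕜)
        * (walsh (𝕜 := 𝕜))^[m] x i := by
    intro x i
    rw [list_prod_walsh_apply T (fun k n => (weight (1 / σ k) (2 / σ k + 1) n : 𝕜)) hT,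
      ← prod_weight, RCLike.ofReal_prod]
  have hm' : (1 : ℝ) ≤ m := by exact_mod_cast hm
  have hα : 1 / 2 ≤ ∑ k, 1 / σ k := by
    calc (1 / 2 : ℝ) ≤ ∑ _k : Fin m, (1 / 2 : ℝ) := by
          rw [Finset.sum_const, Finset.card_univ, Fintype.card_fin, nsmul_eq_mul]
          linarith
      _ ≤ _ := Finset.sum_le_sum fun k _ => one_div_le_one_div_of_le (hσ k).1 (hσ k).2
  have hQ : 2 * ∑ k, 1 / σ k ≤ ∑ k, (2 / σ k + 1) - 1 := by
    rw [Finset.sum_add_distrib, Finset.mul_sum]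
    simp only [Finset.sum_const, Finset.card_univ, Fintype.card_fin, nsmul_eq_mul, mul_one_div]
    linarith
  refine ⟨T, hTn, factorsThroughSchatten_walsh hprod hα hQ hs, fun t ht hts H _ _ _ => ?_⟩
  have htt : t ≠ ∞ := hts.ne_top
  have ht' : 0 < t.toReal := ENNReal.toReal_pos ht.ne' htt
  refine not_factorsThroughSchatten_walsh hprod ht' ?_
  have h1 : s⁻¹ < t⁻¹ := ENNReal.inv_lt_inv.2 hts
  rw [hs] at h1
  have h2 := (ENNReal.toReal_lt_toReal ENNReal.ofReal_ne_top (ENNReal.inv_ne_top.2 ht.ne')).2 h1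
  rwa [ENNReal.toReal_ofReal (by linarith), ENNReal.toReal_inv, ← one_div] at h2
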